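/- Let $\mathcal V$ be a set of variables, and let $O_e,O_p\subseteq\mathcal V$ be disjoint sets, the output variables of the environment and of a process $p$. A trace over $W\subseteq\mathcal V$ is an infinite sequence in $(2^{W})^\omega$; traces $x_0x_1\ldots$ and $y_0y_1\ldots$ are combined by $x_0x_1\ldots\sqcup y_0y_1\ldots=(x_0\cup y_0)(x_1\cup y_1)\ldots$. A trace $\pi$ finitely violates an LTL formula $\varphi$, written $\pi\nvDash_f\varphi$, if $\pi$ has a finite prefix $w$ such that every infinite trace extending $w$ violates $\varphi$. For an LTL formula $\varphi_p$ that refers only to variables in $O_p\cup O_e$ (a local specification of $p$), the time-bounded distinguishability relation is $$\Lambda_p=\{(\pi_e,\pi_e')\in(2^{O_e})^\omega\times(2^{O_e})^\omega \mid \forall \pi_p\in(2^{O_p})^\omega:\ \pi_e\sqcup\pi_p\vDash\varphi_p \Rightarrow \pi_e'\sqcup\pi_p\nvDash_f\varphi_p\}.$$ A universal $\omega$-automaton with parity acceptance condition consists of a finite set $Q$ of states, an initial state, a transition relation assigning to each state and letter a set of successor states, and a priority in $\mathbb N$ for each state; it accepts an infinite word iff on every run on the word the greatest priority occurring infinitely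 often is even. Theorem. There is a constant $c\in\mathbb N$ such that for all $\mathcal V$, $O_e$, $O_p$ and $\varphi_p$ as above there is a universal $\omega$-automaton (with parity acceptance condition) over the alphabet $2^{O_e}\times 2^{O_e}$ that recognizes $\Lambda_p$, i.e. that accepts $(\sigma_0,\sigma_0')(\sigma_1,\sigma_1')\ldots$ iff $(\sigma_0\sigma_1\ldots,\sigma_0'\sigma_1'\ldots)\in\Lambda_p$, and whose number of states is at most doubly exponential in the length $|\varphi_p|$ of $\varphi_p$, namely at most $2^{2^{c\,|\varphi_p|}}$. -/

import Mathlib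

/-- Formulas of linear-time temporal logic over a type `V` of atomic propositions (variables). -/
inductive LTLFormula (V : Type*) where
  | tt : LTLFormula V
  | atom : V → LTLFormula V
  | neg : LTLFormula V → LTLFormula V
  | and : LTLFormula V → LTLFormula V → LTLFormula V
  | or : LTLFormula V → LTLFormula V → LTLFormula V
  | next : LTLFormula V → LTLFormula V
  | until : LTLFormula V → LTLFormula V → LTLFormula V
  | globally : LTLFormula V → LTLFormula V
  | eventually : LTLFormula V → LTLFormula V

/-- The length of a formula: the number of occurrences of operators and atomic propositions. -/
def LTLFormula.length {V : Type*} : LTLFormula V → ℕ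
  | .tt => 1
  | .atom _ => 1
  | .neg φ => φ.length + 1
  | .and φ ψ => φ.length + ψ.length + 1
  | .or φ ψ => φ.length + ψ.length + 1
  | .next φ => φ.length + 1
  | .until φ ψ => φ.length + ψ.length + 1
  | .globally φ => φ.length + 1
  | .eventually φ => φ.length + 1

/-- The set of variables that a formula refers to. -/
def LTLFormula.vars {V : Type*} : LTLFormula V → Set V
  | .tt => ∅
  | .atom v => {v}
  | .neg φ => φ.vars
  | .and φ ψ => φ.vars ∪ ψ.vars
  | .or φ ψ => φ.vars ∪ ψ.vars
  | .next φ => φ.vars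
  | .until φ ψ => φ.vars ∪ ψ.vars
  | .globally φ => φ.vars
  | .eventually φ => φ.vars

/-- `φ.HoldsAt σ i`: the formula `φ` holds at position `i` of the trace `σ`, where a valuation of
the variables is the set of those variables that are true. -/
def LTLFormula.HoldsAt {V : Type*} : LTLFormula V → (ℕ → Set V) → ℕ → Prop
  | .tt, _, _ => True
  | .atom v, σ, i => v ∈ σ i
  | .neg φ, σ, i => ¬ φ.HoldsAt σ i
  | .and φ ψ, σ, i => φ.HoldsAt σ i ∧ ψ.HoldsAt σ i
  | .or φ ψ, σ, i => φ.HoldsAt σ i ∨ ψ.HoldsAt σ i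
  | .next φ, σ, i => φ.HoldsAt σ (i + 1)
  | .until φ ψ, σ, i => ∃ j, i ≤ j ∧ ψ.HoldsAt σ j ∧ ∀ k, i ≤ k → k < j → φ.HoldsAt σ k
  | .globally φ, σ, i => ∀ j, i ≤ j → φ.HoldsAt σ j
  | .eventually φ, σ, i => ∃ j, i ≤ j ∧ φ.HoldsAt σ j

/-- `σ ⊨ φ`. -/
def LTLFormula.Satisfies {V : Type*} (σ : ℕ → Set V) (φ : LTLFormula V) : Prop :=
  φ.HoldsAt σ 0

/-- `σ` finitely violates `φ`: it has a finite prefix all of whose infinite extensions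
violate `φ`. -/
def LTLFormula.FinitelyViolates {V : Type*} (σ : ℕ → Set V) (φ : LTLFormula V) : Prop :=
  ∃ n : ℕ, ∀ τ : ℕ → Set V, (∀ i, i < n → τ i = σ i) → ¬ LTLFormula.Satisfies τ φ

/-- The combination `σ ⊔ τ` of traces over two sets of variables: the positionwise union of the
valuations. A trace over `W` is a sequence of subsets of `W`. -/
def combineTraces {V : Type*} {W W' : Set V} (σ : ℕ → Set W) (τ : ℕ → Set W') : ℕ → Set V :=
  fun i => Subtype.val '' σ i ∪ Subtype.val '' τ i

/-- The time-bounded distinguishability relation of a process with output variables `Op` and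
specification `φ`, in an environment with output variables `Oe`. -/
def timeBoundedDistinguishability {V : Type*} (Oe Op : Set V) (φ : LTLFormula V) :
    Set ((ℕ → Set Oe) × (ℕ → Set Oe)) :=
  {π | ∀ πp : ℕ → Set Op, LTLFormula.Satisfies (combineTraces π.1 πp) φ →
    LTLFormula.FinitelyViolates (combineTraces π.2 πp) φ}

/-- The representation of a relation between infinite words as a set of infinite words over the
product alphabet. -/
def relationWords {S T : Type*} (R : Set ((ℕ → S) × (ℕ → T))) : Set (ℕ → S × T) :=
  {w | ((fun i => (w i).1), (fun i => (w i).2)) ∈ R}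

/-- An ω-automaton over the alphabet `S` with states `Q`, a designated initial state, a transition
relation, and a parity acceptance condition. -/
structure OmegaAutomaton (S Q : Type*) where
  init : Q
  trans : Q → S → Set Q
  priority : Q → ℕ

namespace OmegaAutomaton

variable {S Q : Type*}

/-- `r` is a run of `A` on the infinite word `w`. -/
def IsRun (A : OmegaAutomaton S Q) (w : ℕ → S) (r : ℕ → Q) : Prop :=
  r 0 = A.init ∧ ∀ i, r (i + 1) ∈ A.trans (r i) (w i)

/-- The parity condition: the greatest priority that occurs infinitely often along `r` exists
and is even. -/
def Accepting (A : OmegaAutomaton S Q) (r : ℕ → Q) : Prop :=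
  ∃ k : ℕ, Even k ∧ (∃ᶠ i in Filter.atTop, A.priority (r i) = k) ∧
    ∀ᶠ i in Filter.atTop, A.priority (r i) ≤ k

/-- The language of `A` as a universal automaton: a word is accepted iff all runs on it are
accepting. -/
def universalLanguage (A : OmegaAutomaton S Q) : Set (ℕ → S) :=
  {w | ∀ r : ℕ → Q, A.IsRun w r → A.Accepting r}

end OmegaAutomaton

/-!
The complement of `timeBoundedDistinguishability Oe Op φ` consists of the pairs `(π, π')` for which
some trace `πp` of the process makes `π ⊔ πp` satisfy `φ` while `π' ⊔ πp` does not finitely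
violate `φ`. A nondeterministic Büchi automaton recognizes this complement: it guesses `πp` letter
by letter and runs two tableaux for `φ` in parallel. Read as a universal automaton, with the
accepting states given priority `1` and all others priority `0`, it recognizes the relation itself
(`OmegaAutomaton.exists_universalLanguage_eq_compl`).

The tableau for a trace `σ` guesses, at each position, the set of subformulas of `φ` that hold
there. Two consecutive sets and a letter are compatible if they occur together somewhere on some
trace (`LTLFormula.truthSet`).

* A compatible sequence of guesses is the sequence of true sets of `σ` as soon as every eventuality
  is met infinitely often (`LTLFormula.holdsAt_iff_of_chain`). A single Büchi condition expresses
  this, by a set of pending eventualities which is refilled when it becomes empty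
  (`frequently_pending_eq_empty_iff`). This decides `π ⊔ πp ⊨ φ`.
* Without the fairness condition, a compatible sequence of guesses that starts with `φ` exists iff
  every finite prefix of `σ` extends to a trace satisfying `φ`, that is, iff `σ` does not finitely
  violate `φ` (`LTLFormula.not_finitelyViolates_iff`). In one direction, a continuation that
  realizes the `n`-th guess may be prefixed by the first `n` letters of `σ`, because the truth set
  at a position is determined by the letter and the next truth set. In the other direction, the
  truth sets of ever better approximations of `σ` have a limit along a nonprincipal ultrafilter,
  as there are only finitely many truth sets.

With `n` subformulas the automaton has `(2 ^ n) ^ 3 + 1` states, so the number of states is in fact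
only singly exponential.
-/

open Filter

/-! ### Unfolding and uniqueness of the until operator -/

theorem exists_until_iff_unfold (a b : ℕ → Prop) (i : ℕ) :
    (∃ j, i ≤ j ∧ b j ∧ ∀ k, i ≤ k → k < j → a k) ↔
      b i ∨ a i ∧ ∃ j, i + 1 ≤ j ∧ b j ∧ ∀ k, i + 1 ≤ k → k < j → a k := by
  constructor
  · rintro ⟨j, hij, hb, ha⟩
    rcases hij.eq_or_lt with rfl | hlt
    · exact Or.inl hb
    · exact Or.inr ⟨ha i le_rfl hlt, j, hlt, hb, fun k hk hkj => ha k (by omega) hkj⟩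
  · rintro (hb | ⟨ha, j, hij, hb, h⟩)
    · exact ⟨i, le_rfl, hb, fun k h1 h2 => by omega⟩
    · refine ⟨j, by omega, hb, fun k h1 h2 => ?_⟩
      rcases h1.eq_or_lt with rfl | hlt
      · exact ha
      · exact h k hlt h2

/-- Among the solutions of the fixed point equation of the until operator, fairness singles out the
least one. -/
theorem iff_exists_until_of_frequently {a b u : ℕ → Prop}
    (hu : ∀ i, u i ↔ b i ∨ a i ∧ u (i + 1)) (hf : ∃ᶠ i in atTop, (u i → b i)) (i : ℕ) :
    u i ↔ ∃ j, i ≤ j ∧ b j ∧ ∀ k, i ≤ k → k < j → a k := by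
  constructor
  · intro hi
    obtain ⟨n, hn, hfn⟩ := frequently_atTop.1 hf i
    obtain ⟨d, rfl⟩ := Nat.exists_eq_add_of_le hn
    clear hn
    induction d generalizing i with
    | zero => exact ⟨i, le_rfl, hfn hi, fun k h1 h2 => by omega⟩
    | succ d ih =>
      rw [exists_until_iff_unfold]
      rcases (hu i).1 hi with hb | ⟨ha, hs⟩
      · exact Or.inl hb
      · refine Or.inr ⟨ha, ih (i + 1) hs ?_⟩
        rwa [show i + 1 + d = i + (d + 1) by omega]
  · rintro ⟨j, hij, hb, ha⟩
    obtain ⟨d, rfl⟩ := Nat.exists_eq_add_of_le hij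
    clear hij
    induction d generalizing i with
    | zero => exact (hu i).2 (Or.inl hb)
    | succ d ih =>
      refine (hu i).2 (Or.inr ⟨ha i le_rfl (by omega), ih (i + 1) ?_ fun k h1 h2 =>
        ha k (by omega) (by omega)⟩)
      rwa [show i + 1 + d = i + (d + 1) by omega]

/-! ### Subformulas, expansion laws and truth sets -/

namespace LTLFormula

variable {V : Type*}

/-- The set of subformulas of a formula, including the formula itself. -/
def subformulas : LTLFormula V → Set (LTLFormula V)
  | .tt => {.tt}
  | .atom v => {.atom v}
  | .neg φ => insert (.neg φ) φ.subformulas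
  | .and φ ψ => insert (.and φ ψ) (φ.subformulas ∪ ψ.subformulas)
  | .or φ ψ => insert (.or φ ψ) (φ.subformulas ∪ ψ.subformulas)
  | .next φ => insert (.next φ) φ.subformulas
  | .until φ ψ => insert (.until φ ψ) (φ.subformulas ∪ ψ.subformulas)
  | .globally φ => insert (.globally φ) φ.subformulas
  | .eventually φ => insert (.eventually φ) φ.subformulas

theorem mem_subformulas_self (φ : LTLFormula V) : φ ∈ φ.subformulas := by
  cases φ <;> simp [subformulas]

theorem one_le_length (φ : LTLFormula V) : 1 ≤ φ.length := by
  cases φ <;> simp [length]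

theorem finite_subformulas (φ : LTLFormula V) : φ.subformulas.Finite := by
  induction φ <;> simp_all [subformulas]

theorem ncard_subformulas_le (φ : LTLFormula V) : φ.subformulas.ncard ≤ φ.length := by
  induction φ with
  | tt => simp [subformulas, length]
  | atom v => simp [subformulas, length]
  | neg φ ih | next φ ih | globally φ ih | eventually φ ih =>
    exact (Set.ncard_insert_le _ _).trans (Nat.succ_le_succ ih)
  | _ φ ψ ih ih' =>
    exact (Set.ncard_insert_le _ _).trans
      (Nat.succ_le_succ ((Set.ncard_union_le _ _).trans (Nat.add_le_add ih ih')))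

theorem holdsAt_until_iff (φ ψ : LTLFormula V) (σ : ℕ → Set V) (i : ℕ) :
    (φ.until ψ).HoldsAt σ i ↔
      ψ.HoldsAt σ i ∨ φ.HoldsAt σ i ∧ (φ.until ψ).HoldsAt σ (i + 1) :=
  exists_until_iff_unfold (φ.HoldsAt σ) (ψ.HoldsAt σ) i

theorem holdsAt_eventually_iff (φ : LTLFormula V) (σ : ℕ → Set V) (i : ℕ) :
    φ.eventually.HoldsAt σ i ↔ φ.HoldsAt σ i ∨ φ.eventually.HoldsAt σ (i + 1) := by
  simpa [HoldsAt] using exists_until_iff_unfold (fun _ => True) (φ.HoldsAt σ) i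

theorem not_holdsAt_globally_iff (φ : LTLFormula V) (σ : ℕ → Set V) (i : ℕ) :
    ¬ φ.globally.HoldsAt σ i ↔ ¬ φ.HoldsAt σ i ∨ ¬ φ.globally.HoldsAt σ (i + 1) := by
  simpa [HoldsAt] using exists_until_iff_unfold (fun _ => True) (fun j => ¬ φ.HoldsAt σ j) i

/-- Whether a formula holds depends only on the present letter and on which of its subformulas
hold at the next position. -/
theorem holdsAt_iff_of_succ {σ ρ : ℕ → Set V} {i j : ℕ} (h0 : σ i = ρ j) (φ : LTLFormula V)
    (h : ∀ ψ ∈ φ.subformulas, ψ.HoldsAt σ (i + 1) ↔ ψ.HoldsAt ρ (j + 1)) :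
    φ.HoldsAt σ i ↔ φ.HoldsAt ρ j := by
  have hself := h φ φ.mem_subformulas_self
  induction φ with
  | tt => simp [HoldsAt]
  | atom v => simp [HoldsAt, h0]
  | neg φ ih =>
    have h1 := fun ψ hψ => h ψ (Or.inr hψ)
    simp only [HoldsAt, ih h1 (h1 _ φ.mem_subformulas_self)]
  | next φ ih => exact h φ (Or.inr φ.mem_subformulas_self)
  | globally φ ih =>
    have h1 := fun ψ hψ => h ψ (Or.inr hψ)
    rw [← not_iff_not, not_holdsAt_globally_iff, not_holdsAt_globally_iff _ ρ, hself,
      propext (ih h1 (h1 _ φ.mem_subformulas_self))]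
  | eventually φ ih =>
    have h1 := fun ψ hψ => h ψ (Or.inr hψ)
    rw [holdsAt_eventually_iff, holdsAt_eventually_iff _ ρ, hself,
      propext (ih h1 (h1 _ φ.mem_subformulas_self))]
  | and φ ψ ih ih' | or φ ψ ih ih' =>
    have h1 := fun χ hχ => h χ (Or.inr (Or.inl hχ))
    have h2 := fun χ hχ => h χ (Or.inr (Or.inr hχ))
    simp only [HoldsAt, ih h1 (h1 _ φ.mem_subformulas_self), ih' h2 (h2 _ ψ.mem_subformulas_self)]
  | _ φ ψ ih ih' =>
    have h1 := fun χ hχ => h χ (Or.inr (Or.inl hχ))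
    have h2 := fun χ hχ => h χ (Or.inr (Or.inr hχ))
    rw [holdsAt_until_iff, holdsAt_until_iff _ _ ρ, hself,
      propext (ih h1 (h1 _ φ.mem_subformulas_self)),
      propext (ih' h2 (h2 _ ψ.mem_subformulas_self))]

theorem holdsAt_congr_suffix {σ ρ : ℕ → Set V} {n m : ℕ} (h : ∀ d, σ (n + d) = ρ (m + d))
    (φ : LTLFormula V) (d : ℕ) : φ.HoldsAt σ (n + d) ↔ φ.HoldsAt ρ (m + d) := by
  -- A statement about the positions from `n + d` on is one about offsets `e ≥ d`.
  have key : ∀ (P : ℕ → Prop) (n d : ℕ), (∃ j, n + d ≤ j ∧ P j) ↔ ∃ e, d ≤ e ∧ P (n + e) := by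
    intro P n d
    constructor
    · rintro ⟨j, hj, hP⟩
      exact ⟨j - n, by omega, by rwa [show n + (j - n) = j by omega]⟩
    · rintro ⟨e, he, hP⟩
      exact ⟨n + e, by omega, hP⟩
  have key' : ∀ (P : ℕ → Prop) (n d : ℕ), (∀ j, n + d ≤ j → P j) ↔ ∀ e, d ≤ e → P (n + e) := by
    intro P n d
    have := not_congr (key (fun j => ¬ P j) n d)
    push Not at this
    exact this
  induction φ generalizing d with
  | tt => simp [HoldsAt]
  | atom v => simp [HoldsAt, h]
  | neg φ ih => simp only [HoldsAt, ih]
  | and φ ψ ih ih' | or φ ψ ih ih' => simp only [HoldsAt, ih, ih']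
  | next φ ih => exact ih (d + 1)
  | globally φ ih => simp only [HoldsAt, key', ih]
  | eventually φ ih => simp only [HoldsAt, key, ih]
  | _ φ ψ ih ih' => simp only [HoldsAt, key, key', Nat.add_lt_add_iff_left, ih, ih']

/-- The set of those subformulas of `φ` that hold at position `i` of `σ`. -/
def truthSet (φ : LTLFormula V) (σ : ℕ → Set V) (i : ℕ) : Set φ.subformulas :=
  {ψ | ψ.1.HoldsAt σ i}

theorem holdsAt_iff_of_truthSet_eq {φ ψ : LTLFormula V} (hψ : ψ ∈ φ.subformulas)
    {σ ρ : ℕ → Set V} {i j : ℕ} (h : φ.truthSet σ i = φ.truthSet ρ j) :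
    ψ.HoldsAt σ i ↔ ψ.HoldsAt ρ j :=
  Set.ext_iff.1 h ⟨ψ, hψ⟩

theorem subformulas_subset {φ ψ : LTLFormula V} (h : ψ ∈ φ.subformulas) :
    ψ.subformulas ⊆ φ.subformulas := by
  induction φ with
  | tt | atom v => rw [show ψ = _ from h]
  | neg φ ih | next φ ih | globally φ ih | eventually φ ih =>
    rcases h with rfl | h
    · rfl
    · exact fun χ hχ => Or.inr (ih h hχ)
  | _ φ ψ ih ih' =>
    rcases h with rfl | h | h
    · rfl
    · exact fun χ hχ => Or.inr (Or.inl (ih h hχ))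
    · exact fun χ hχ => Or.inr (Or.inr (ih' h hχ))

theorem truthSet_eq_of_succ (φ : LTLFormula V) {σ ρ : ℕ → Set V} {i j : ℕ} (h0 : σ i = ρ j)
    (h : φ.truthSet σ (i + 1) = φ.truthSet ρ (j + 1)) : φ.truthSet σ i = φ.truthSet ρ j := by
  ext ⟨ψ, hψ⟩
  exact holdsAt_iff_of_succ h0 ψ fun χ hχ =>
    holdsAt_iff_of_truthSet_eq (subformulas_subset hψ hχ) h

/-! ### Fair sequences of truth sets -/

/-- The fairness condition of a formula at a position of a trace: a formula that promises something
for the future (an until, an eventually, or the negation of a globally) either does not hold, or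
its promise is kept right now. For all other formulas the condition is void. -/
def EventualityMet : LTLFormula V → (ℕ → Set V) → ℕ → Prop
  | .until φ ψ, σ, i => (φ.until ψ).HoldsAt σ i → ψ.HoldsAt σ i
  | .eventually φ, σ, i => φ.eventually.HoldsAt σ i → φ.HoldsAt σ i
  | .globally φ, σ, i => φ.HoldsAt σ i → φ.globally.HoldsAt σ i
  | _, _, _ => True

theorem frequently_eventualityMet (φ : LTLFormula V) (σ : ℕ → Set V) :
    ∃ᶠ i in atTop, φ.EventualityMet σ i := by
  refine frequently_atTop.2 fun N => ?_
  cases φ with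
  | tt | atom | neg | and | or | next => exact ⟨N, le_rfl, trivial⟩
  | eventually φ =>
    by_cases h : φ.eventually.HoldsAt σ N
    · obtain ⟨j, hj, hφ⟩ := h
      exact ⟨j, hj, fun _ => hφ⟩
    · exact ⟨N, le_rfl, fun h' => absurd h' h⟩
  | globally φ =>
    by_cases h : φ.globally.HoldsAt σ N
    · exact ⟨N, le_rfl, fun _ => h⟩
    · simp only [HoldsAt] at h
      push Not at h
      obtain ⟨j, hj, hφ⟩ := h
      exact ⟨j, hj, fun h' => absurd h' hφ⟩
  -- The only constructor left is the until operator.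
  | _ φ ψ =>
    by_cases h : (φ.until ψ).HoldsAt σ N
    · obtain ⟨j, hj, hψ, -⟩ := h
      exact ⟨j, hj, fun _ => hψ⟩
    · exact ⟨N, le_rfl, fun h' => absurd h' h⟩

/-- Soundness of the tableau: if the `i`-th letter of `σ` is that of the position `p i` of a trace
`ρ i`, the truth sets at these positions fit together, and every eventuality is met infinitely
often, then these truth sets are those of `σ`. -/
theorem holdsAt_iff_of_chain {σ : ℕ → Set V} {ρ : ℕ → ℕ → Set V} {p : ℕ → ℕ}
    (h0 : ∀ i, ρ i (p i) = σ i) (φ : LTLFormula V)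
    (hs : ∀ ψ ∈ φ.subformulas, ∀ i,
      ψ.HoldsAt (ρ i) (p i + 1) ↔ ψ.HoldsAt (ρ (i + 1)) (p (i + 1)))
    (hf : ∀ ψ ∈ φ.subformulas, ∃ᶠ i in atTop, ψ.EventualityMet (ρ i) (p i)) (i : ℕ) :
    φ.HoldsAt (ρ i) (p i) ↔ φ.HoldsAt σ i := by
  have hself := hs φ φ.mem_subformulas_self
  have fself := hf φ φ.mem_subformulas_self
  induction φ generalizing i with
  | tt => simp [HoldsAt]
  | atom v => simp [HoldsAt, h0]
  | neg φ ih =>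
    have h1 := fun ψ hψ => hs ψ (Or.inr hψ)
    have f1 := fun ψ hψ => hf ψ (Or.inr hψ)
    have e1 := fun i => ih h1 f1 i (h1 _ φ.mem_subformulas_self) (f1 _ φ.mem_subformulas_self)
    simp only [HoldsAt, e1]
  | next φ ih =>
    have h1 := fun ψ hψ => hs ψ (Or.inr hψ)
    have f1 := fun ψ hψ => hf ψ (Or.inr hψ)
    have e1 := fun i => ih h1 f1 i (h1 _ φ.mem_subformulas_self) (f1 _ φ.mem_subformulas_self)
    exact (h1 φ φ.mem_subformulas_self i).trans (e1 (i + 1))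
  | globally φ ih =>
    have h1 := fun ψ hψ => hs ψ (Or.inr hψ)
    have f1 := fun ψ hψ => hf ψ (Or.inr hψ)
    have e1 := fun i => ih h1 f1 i (h1 _ φ.mem_subformulas_self) (f1 _ φ.mem_subformulas_self)
    have := iff_exists_until_of_frequently (a := fun _ => True) (b := fun i => ¬ φ.HoldsAt σ i)
      (u := fun i => ¬ φ.globally.HoldsAt (ρ i) (p i))
      (fun i => by simp only [true_and]; rw [not_holdsAt_globally_iff, hself, propext (e1 i)])
      (fself.mono fun i hi hn hφ => hn (hi ((e1 i).2 hφ))) i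
    rw [← not_iff_not, this]
    simp [HoldsAt]
  | eventually φ ih =>
    have h1 := fun ψ hψ => hs ψ (Or.inr hψ)
    have f1 := fun ψ hψ => hf ψ (Or.inr hψ)
    have e1 := fun i => ih h1 f1 i (h1 _ φ.mem_subformulas_self) (f1 _ φ.mem_subformulas_self)
    have := iff_exists_until_of_frequently (a := fun _ => True) (b := fun i => φ.HoldsAt σ i)
      (u := fun i => φ.eventually.HoldsAt (ρ i) (p i))
      (fun i => by simp only [true_and]; rw [holdsAt_eventually_iff, hself, propext (e1 i)])
      (fself.mono fun i hi hn => (e1 i).1 (hi hn)) i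
    rw [this]
    simp [HoldsAt]
  | and φ ψ ih ih' | or φ ψ ih ih' =>
    have h1 := fun χ hχ => hs χ (Or.inr (Or.inl hχ))
    have h2 := fun χ hχ => hs χ (Or.inr (Or.inr hχ))
    have f1 := fun χ hχ => hf χ (Or.inr (Or.inl hχ))
    have f2 := fun χ hχ => hf χ (Or.inr (Or.inr hχ))
    have e1 := fun i => ih h1 f1 i (h1 _ φ.mem_subformulas_self) (f1 _ φ.mem_subformulas_self)
    have e2 := fun i => ih' h2 f2 i (h2 _ ψ.mem_subformulas_self) (f2 _ ψ.mem_subformulas_self)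
    simp only [HoldsAt, e1, e2]
  | _ φ ψ ih ih' =>
    have h1 := fun χ hχ => hs χ (Or.inr (Or.inl hχ))
    have h2 := fun χ hχ => hs χ (Or.inr (Or.inr hχ))
    have f1 := fun χ hχ => hf χ (Or.inr (Or.inl hχ))
    have f2 := fun χ hχ => hf χ (Or.inr (Or.inr hχ))
    have e1 := fun i => ih h1 f1 i (h1 _ φ.mem_subformulas_self) (f1 _ φ.mem_subformulas_self)
    have e2 := fun i => ih' h2 f2 i (h2 _ ψ.mem_subformulas_self) (f2 _ ψ.mem_subformulas_self)
    exact iff_exists_until_of_frequently (a := φ.HoldsAt σ) (b := ψ.HoldsAt σ)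
      (u := fun i => (φ.until ψ).HoldsAt (ρ i) (p i))
      (fun i => by rw [holdsAt_until_iff, hself, propext (e1 i), propext (e2 i)])
      (fself.mono fun i hi hn => (e2 i).1 (hi hn)) i

/-! ### Finite violation -/

/-- A trace does not finitely violate `φ` iff it has a compatible sequence of truth sets that
starts with one containing `φ`. -/
theorem not_finitelyViolates_iff (φ : LTLFormula V) (σ : ℕ → Set V) :
    ¬ FinitelyViolates σ φ ↔ ∃ B : ℕ → Set φ.subformulas,
      ⟨φ, φ.mem_subformulas_self⟩ ∈ B 0 ∧
      ∀ i, ∃ (ρ : ℕ → Set V) (j : ℕ),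
        ρ j = σ i ∧ φ.truthSet ρ j = B i ∧ φ.truthSet ρ (j + 1) = B (i + 1) := by
  have := φ.finite_subformulas.to_subtype
  simp only [FinitelyViolates, not_exists, not_forall, not_not]
  constructor
  · intro h
    choose τ hτ hsat using h
    have lim : ∀ i, ∃ B : Set φ.subformulas, ∀ᶠ n in (hyperfilter ℕ : Filter ℕ),
        φ.truthSet (τ n) i = B := by
      intro i
      by_contra hB
      rw [not_exists] at hB
      have h1 : ∀ᶠ n in (hyperfilter ℕ : Filter ℕ), ∀ B, ¬ φ.truthSet (τ n) i = B :=
        eventually_all.2 fun B => Ultrafilter.eventually_not.2 (hB B)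
      obtain ⟨n, hn⟩ := h1.exists
      exact hn _ rfl
    choose B hB using lim
    refine ⟨B, ?_, fun i => ?_⟩
    · obtain ⟨n, hn⟩ := (hB 0).exists
      rw [← hn]
      exact hsat n
    · have hlarge : ∀ᶠ n in (hyperfilter ℕ : Filter ℕ), i < n :=
        Nat.hyperfilter_le_atTop (eventually_gt_atTop i)
      obtain ⟨n, h1, h2, h3⟩ := ((hB i).and ((hB (i + 1)).and hlarge)).exists
      exact ⟨τ n, i, hτ n i h3, h1, h2⟩
  · rintro ⟨B, hB0, hB⟩ n
    obtain ⟨ρ, j, -, hρ, -⟩ := hB n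
    let τ : ℕ → Set V := fun i => if i < n then σ i else ρ (j + (i - n))
    have hτ : ∀ i, i < n → τ i = σ i := fun i hi => if_pos hi
    have hn : φ.truthSet τ n = B n := by
      rw [← hρ]
      ext ψ
      exact holdsAt_congr_suffix (n := n) (m := j) (fun d => by simp [τ]) ψ.1 0
    have hback : ∀ d, d ≤ n → φ.truthSet τ (n - d) = B (n - d) := by
      intro d
      induction d with
      | zero => exact fun _ => hn
      | succ d ih =>
        intro hd
        obtain ⟨ρ', j', h0, h1, h2⟩ := hB (n - (d + 1))
        rw [← h1]
        refine truthSet_eq_of_succ φ ((hτ _ (by omega)).trans h0.symm) ?_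
        rw [h2, show n - (d + 1) + 1 = n - d by omega, ih (by omega)]
    have h0 := hback n le_rfl
    rw [Nat.sub_self] at h0
    refine ⟨τ, hτ, ?_⟩
    rw [← h0] at hB0
    exact hB0

end LTLFormula

/-! ### A single Büchi condition for finitely many -/

/-- Let `f n` be the set of conditions met at step `n`, and `P n` the set of conditions still
pending, which loses the conditions being met and is refilled when it has become empty. Then it
becomes empty infinitely often iff every condition is met infinitely often. -/
theorem frequently_pending_eq_empty_iff {ι : Type*} [Finite ι] {P f : ℕ → Set ι}
    (h0 : ∀ n, P n = ∅ → P (n + 1) = Set.univ) (h1 : ∀ n, P n ≠ ∅ → P (n + 1) = P n \ f n) :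
    (∃ᶠ n in atTop, P n = ∅) ↔ ∀ k, ∃ᶠ n in atTop, k ∈ f n := by
  constructor
  · intro h k
    refine frequently_atTop.2 fun N => ?_
    obtain ⟨n, hn, hPn⟩ := frequently_atTop.1 h N
    obtain ⟨m, hm, hPm⟩ := frequently_atTop.1 h (n + 1)
    by_contra! hk
    have hmem : ∀ d, k ∈ P (n + 1 + d) := by
      intro d
      induction d with
      | zero => simp [h0 n hPn]
      | succ d ih =>
        rw [← add_assoc, h1 _ (Set.nonempty_of_mem ih).ne_empty]
        exact ⟨ih, hk _ (by omega)⟩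
    have := hmem (m - (n + 1))
    rw [Nat.add_sub_cancel' hm, hPm] at this
    exact this
  · intro h
    refine frequently_atTop.2 fun N => ?_
    by_contra! hN
    have hanti : ∀ k n, N ≤ n → k ∉ P n → ∀ᶠ m in atTop, k ∉ P m := by
      intro k n hn hk
      refine eventually_atTop.2 ⟨n, fun m hm => ?_⟩
      induction m, hm using Nat.le_induction with
      | base => exact hk
      | succ m hm ih =>
        rw [h1 m (hN m (hn.trans hm)).ne_empty]
        exact fun hmem => ih hmem.1
    have hall : ∀ᶠ m in atTop, ∀ k, k ∉ P m := by
      refine eventually_all.2 fun k => ?_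
      obtain ⟨n, hn, hk⟩ := frequently_atTop.1 (h k) N
      refine hanti k (n + 1) (by omega) ?_
      rw [h1 n (hN n hn).ne_empty]
      exact fun hmem => hmem.2 hk
    obtain ⟨m, hm, hmN⟩ := (hall.and (eventually_ge_atTop N)).exists
    obtain ⟨k, hk⟩ := hN m hmN
    exact hm k hk

/-! ### Dualization of nondeterministic Büchi automata -/

/-- The complement of the language of a nondeterministic Büchi automaton, here with a set `I` of
initial states, transitions `δ` and accepting states `F`, is the language of a universal parity
automaton with one more state, the extra state being the designated initial one. Indexing the
states by `Fin` places them in `Type`, whatever the universe of `Q`. -/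
theorem OmegaAutomaton.exists_universalLanguage_eq_compl {S Q : Type*} [Finite Q]
    (I : Set Q) (δ : Q → S → Set Q) (F : Set Q) :
    ∃ A : OmegaAutomaton S (Fin (Nat.card Q + 1)),
      A.universalLanguage = {w | ∃ r : ℕ → Q, r 0 ∈ I ∧ (∀ i, r (i + 1) ∈ δ (r i) (w i)) ∧
        ∃ᶠ i in atTop, r i ∈ F}ᶜ := by
  classical
  obtain ⟨e⟩ : Nonempty (Fin (Nat.card Q + 1) ≃ Option Q) :=
    ⟨(Finite.equivFinOfCardEq Finite.card_option).symm⟩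
  let A : OmegaAutomaton S (Fin (Nat.card Q + 1)) :=
    { init := e.symm none
      trans := fun q x => {q' | ∃ t p, e q' = some t ∧ (e q = some p ∨ e q = none ∧ p ∈ I) ∧
        t ∈ δ p x}
      priority := fun q => if ∃ p ∈ F, e q = some p then 1 else 0 }
  -- Only the priorities `0` and `1` occur, so a run is rejecting iff `1` recurs.
  have hacc : ∀ r, A.Accepting r ↔ ¬ ∃ᶠ i in atTop, ∃ p ∈ F, e (r i) = some p := by
    intro r
    constructor
    · rintro ⟨k, hk, hfr', hle⟩ hfr
      obtain ⟨i, hi, hik⟩ := (hfr.and_eventually hle).exists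
      have h1 : 1 ≤ k := by simpa only [A, if_pos hi] using hik
      obtain ⟨j, hj⟩ := hfr'.exists
      have h2 : k ≤ 1 := by
        rw [← hj]
        simp only [A]
        split_ifs <;> simp
      obtain rfl : k = 1 := le_antisymm h2 h1
      exact absurd hk (by decide)
    · intro h
      have h0 : ∀ᶠ i in atTop, A.priority (r i) = 0 :=
        (not_frequently.1 h).mono fun i hi => if_neg hi
      exact ⟨0, Even.zero, h0.frequently, h0.mono fun i hi => hi.le⟩
  refine ⟨A, Set.ext fun w => ?_⟩
  have hlang : w ∈ A.universalLanguage ↔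
      ¬ ∃ r, A.IsRun w r ∧ ∃ᶠ i in atTop, ∃ p ∈ F, e (r i) = some p := by
    simp only [not_exists, not_and, ← hacc]
    rfl
  rw [hlang]
  refine not_congr ⟨?_, ?_⟩
  · rintro ⟨r, ⟨hr0, hr⟩, hfr⟩
    have hnone : e (r 0) = none := by simp [hr0, A]
    obtain ⟨t₁, p, ht₁, hp | ⟨-, hpI⟩, htp⟩ := hr 0
    · simp [hnone] at hp
    have hsome : ∀ i, ∃ t, e (r (i + 1)) = some t := fun i =>
      let ⟨t, _, ht, _⟩ := hr i
      ⟨t, ht⟩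
    choose t ht using hsome
    refine ⟨fun i => Nat.casesOn i p t, hpI, ?_, ?_⟩
    · rintro (_ | i)
      · obtain rfl : t₁ = t 0 := Option.some_injective _ (ht₁.symm.trans (ht 0))
        exact htp
      · obtain ⟨t', p', ht', hp' | ⟨hp', -⟩, hδ⟩ := hr (i + 1)
        · obtain rfl : t' = t (i + 1) := Option.some_injective _ (ht'.symm.trans (ht (i + 1)))
          obtain rfl : p' = t i := Option.some_injective _ (hp'.symm.trans (ht i))
          exact hδ
        · simp [ht i] at hp'
    · refine (hfr.and_eventually (eventually_ge_atTop 1)).mono ?_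
      rintro (_ | i) ⟨⟨q, hq, hqi⟩, hi⟩
      · simp at hi
      · obtain rfl : q = t i := Option.some_injective _ (hqi.symm.trans (ht i))
        exact hq
  · rintro ⟨t, h0, hδ, hfr⟩
    refine ⟨fun i => Nat.casesOn i (e.symm none) fun i => e.symm (some (t (i + 1))),
      ⟨rfl, ?_⟩, ?_⟩
    · rintro (_ | i)
      · exact ⟨t 1, t 0, by simp, Or.inr ⟨by simp, h0⟩, hδ 0⟩
      · exact ⟨t (i + 2), t (i + 1), by simp, Or.inl (by simp), hδ (i + 1)⟩
    · refine (hfr.and_eventually (eventually_ge_atTop 1)).mono ?_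
      rintro (_ | i) ⟨hi, h1⟩
      · simp at h1
      · exact ⟨t (i + 1), hi, by simp⟩

/-! ### The automaton for the distinguishability relation -/

namespace LTLFormula

variable {V : Type*}

/-- The one-step relation of the tableau for `φ` on the letter `x`: the truth set `a` may be
followed by `a'`, where `m` is the set of the subformulas whose eventuality is met. -/
def TableauStep (φ : LTLFormula V) (x : Set V) (a a' m : Set φ.subformulas) : Prop :=
  ∃ (ρ : ℕ → Set V) (j : ℕ), ρ j = x ∧ φ.truthSet ρ j = a ∧ φ.truthSet ρ (j + 1) = a' ∧
    {ψ : φ.subformulas | ψ.1.EventualityMet ρ j} = m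

theorem satisfies_iff_exists_tableau (φ : LTLFormula V) (σ : ℕ → Set V) :
    Satisfies σ φ ↔ ∃ a m : ℕ → Set φ.subformulas, ⟨φ, φ.mem_subformulas_self⟩ ∈ a 0 ∧
      (∀ i, φ.TableauStep (σ i) (a i) (a (i + 1)) (m i)) ∧ ∀ ψ, ∃ᶠ i in atTop, ψ ∈ m i := by
  constructor
  · intro h
    exact ⟨φ.truthSet σ, fun i => {ψ | ψ.1.EventualityMet σ i}, h,
      fun i => ⟨σ, i, rfl, rfl, rfl, rfl⟩, fun ψ => ψ.1.frequently_eventualityMet σ⟩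
  · rintro ⟨a, m, h0, hstep, hfair⟩
    choose ρ p hx ha ha' hm using hstep
    refine (holdsAt_iff_of_chain hx φ (fun ψ hψ i => ?_) (fun ψ hψ => ?_) 0).1 ?_
    · exact holdsAt_iff_of_truthSet_eq hψ ((ha' i).trans (ha (i + 1)).symm)
    · refine (hfair ⟨ψ, hψ⟩).mono fun i hi => ?_
      rw [← hm i] at hi
      exact hi
    · rw [← ha 0] at h0
      exact h0

/-- The states of two tableaux for `φ` that run in parallel: a truth set for `π ⊔ πp`, the pending
eventualities of that tableau, and a truth set for `π' ⊔ πp`. -/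
abbrev TableauState (φ : LTLFormula V) : Type _ :=
  Set φ.subformulas × Set φ.subformulas × Set φ.subformulas

end LTLFormula

open LTLFormula in
/-- The nondeterministic Büchi automaton for the complement of the distinguishability relation.
Each step guesses a letter of `πp`. Both truth sets are guessed for the position about to be
read. -/
theorem exists_buchi_compl_relationWords_timeBoundedDistinguishability {V : Type*} (Oe Op : Set V)
    (φ : LTLFormula V) :
    ∃ (I : Set φ.TableauState) (δ : φ.TableauState → Set Oe × Set Oe → Set φ.TableauState)
      (F : Set φ.TableauState),
      (relationWords (timeBoundedDistinguishability Oe Op φ))ᶜ =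
        {w | ∃ r : ℕ → φ.TableauState,
          r 0 ∈ I ∧ (∀ i, r (i + 1) ∈ δ (r i) (w i)) ∧ ∃ᶠ i in atTop, r i ∈ F} := by
  classical
  have := φ.finite_subformulas.to_subtype
  let top : φ.subformulas := ⟨φ, φ.mem_subformulas_self⟩
  let letter : Set Oe → Set Op → Set V := fun s o => Subtype.val '' s ∪ Subtype.val '' o
  refine ⟨{q | top ∈ q.1 ∧ top ∈ q.2.2},
    fun q x => {q' | ∃ (o : Set Op) (m m' : Set φ.subformulas),
      φ.TableauStep (letter x.1 o) q.1 q'.1 m ∧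
      q'.2.1 = (if q.2.1 = ∅ then Set.univ else q.2.1 \ m) ∧
      φ.TableauStep (letter x.2 o) q.2.2 q'.2.2 m'},
    {q | q.2.1 = ∅}, Set.ext fun w => ?_⟩
  have hw : w ∈ (relationWords (timeBoundedDistinguishability Oe Op φ))ᶜ ↔
      ∃ πp : ℕ → Set Op, Satisfies (fun i => letter (w i).1 (πp i)) φ ∧
        ¬ FinitelyViolates (fun i => letter (w i).2 (πp i)) φ := by
    simp only [relationWords, timeBoundedDistinguishability, Set.mem_compl_iff,
      Set.mem_ofPred_eq, not_forall, exists_prop]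
    rfl
  rw [hw]
  constructor
  · rintro ⟨πp, hsat, hviol⟩
    obtain ⟨a, m, ha0, hstep, hfair⟩ := (satisfies_iff_exists_tableau φ _).1 hsat
    obtain ⟨b, hb0, hb⟩ := (not_finitelyViolates_iff φ _).1 hviol
    obtain ⟨P, hP⟩ : ∃ P : ℕ → Set φ.subformulas,
        ∀ n : ℕ, P (n + 1) = (if P n = ∅ then Set.univ else P n \ m n) :=
      ⟨fun n => Nat.rec ∅ (fun n p => if p = ∅ then Set.univ else p \ m n) n, fun _ => rfl⟩
    refine ⟨fun i => (a i, P i, b i), ⟨ha0, hb0⟩, fun i => ?_, ?_⟩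
    · obtain ⟨ρ, j, h1, h2, h3⟩ := hb i
      exact ⟨πp i, m i, _, hstep i, hP i, ρ, j, h1, h2, h3, rfl⟩
    · exact (frequently_pending_eq_empty_iff (P := P) (fun n hn => (hP n).trans (if_pos hn))
        (fun n hn => (hP n).trans (if_neg hn))).2 hfair
  · rintro ⟨r, ⟨ha0, hb0⟩, hr, hF⟩
    choose πp m m' hstep hP hstep' using hr
    refine ⟨πp, (satisfies_iff_exists_tableau φ _).2 ⟨fun i => (r i).1, m, ha0, hstep, ?_⟩,
      (not_finitelyViolates_iff φ _).2 ⟨fun i => (r i).2.2, hb0, fun i => ?_⟩⟩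
    · exact (frequently_pending_eq_empty_iff (P := fun i => (r i).2.1)
        (fun n hn => (hP n).trans (if_pos hn)) (fun n hn => (hP n).trans (if_neg hn))).1 hF
    · obtain ⟨ρ, j, h1, h2, h3, -⟩ := hstep' i
      exact ⟨ρ, j, h1, h2, h3⟩

theorem theorem4 :
    ∃ c : ℕ, ∀ (V : Type*) (Oe Op : Set V), Disjoint Oe Op →
      ∀ φ : LTLFormula V, φ.vars ⊆ Op ∪ Oe →
        ∃ (Q : Type) (_ : Fintype Q) (A : OmegaAutomaton (Set Oe × Set Oe) Q),
          A.universalLanguage = relationWords (timeBoundedDistinguishability Oe Op φ) ∧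
          Fintype.card Q ≤ 2 ^ 2 ^ (c * φ.length) := by
  refine ⟨4, fun V Oe Op _ φ _ => ?_⟩
  have := φ.finite_subformulas.to_subtype
  obtain ⟨I, δ, F, h⟩ :=
    exists_buchi_compl_relationWords_timeBoundedDistinguishability Oe Op φ
  obtain ⟨A, hA⟩ := OmegaAutomaton.exists_universalLanguage_eq_compl I δ F
  refine ⟨_, inferInstance, A, by rw [hA, ← h, compl_compl], ?_⟩
  have hset : Nat.card (Set φ.subformulas) ≤ 2 ^ φ.length := by
    classical
    have := Fintype.ofFinite φ.subformulas
    rw [Nat.card_eq_fintype_card, Fintype.card_set, ← Nat.card_eq_fintype_card,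
      Nat.card_coe_set_eq]
    exact Nat.pow_le_pow_right two_pos φ.ncard_subformulas_le
  rw [Fintype.card_fin, Nat.card_prod, Nat.card_prod]
  calc _ ≤ 2 ^ φ.length * (2 ^ φ.length * 2 ^ φ.length) + 1 := by gcongr
    _ ≤ 2 ^ (4 * φ.length) := by
      have h1 : 2 ^ φ.length * (2 ^ φ.length * 2 ^ φ.length) = 2 ^ (3 * φ.length) := by ring
      rw [h1, Nat.succ_le_iff]
      exact Nat.pow_lt_pow_right one_lt_two (by have := φ.one_le_length; omega)
    _ ≤ 2 ^ 2 ^ (4 * φ.length) := Nat.pow_le_pow_right two_pos Nat.lt_two_pow_self.le
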